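/- Let $\psi=\Gamma'/\Gamma$ be the digamma function, let $H_m=\sum_{i=1}^m \frac1i$ denote the $m$-th harmonic number, and let $n\ge 0$ be an integer. Empty sums are $0$. The series \[ S(n)=\sum_{k=1}^\infty \frac{\left(\psi\left(\frac{2k+2n+5}{4}\right)-\psi\left(\frac{2k+2n+3}{4}\right)\right)\left(\frac12-(-1)^k\right)}{(2k)^2} \] converges absolutely, and $S(n)=a_0+a_1\pi+a_2\pi^2+a_3\pi^3$ for some rational numbers $a_0,a_1,a_2,a_3$ (depending on $n$). Explicitly: 1. If $n=0$, then $S(0)=2-\pi+\frac{\pi^2}{6}-\frac{\pi^3}{96}$. 2. If $n=1$, then $S(1)=-\frac{70}{27}+\frac{10\pi}{9}-\frac{\pi^2}{9}+\frac{\pi^3}{96}$. 3. If $n$ is odd and $n\neq 1$, then, with $N=\frac{n-1}{2}$, \[ \begin{aligned} S(n)={}&-\frac{70}{27}+8\sum_{j=1}^{N}\frac{(2j+1)(2H_{4j+1}-H_{2j})}{(4j+3)^2(4j+1)^2}+2\sum_{j=1}^{N}\frac{1}{(4j+3)^3}\\ &-8\sum_{k=1}^{N}\sum_{j=0}^{2k}\frac{(-1)^j(16k^2+16k+5)}{(2j+1)(4k+3)^2(4k+1)^2}\\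 &+\left(\frac{10}{9}+\sum_{j=1}^{N}\frac{2(16j^2+16j+5)}{(4j+3)^2(4j+1)^2}\right)\pi\\ &-\left(\frac13+\sum_{j=1}^{N}\frac{1}{(4j+3)(4j+1)}\right)\frac{\pi^2}{3}+\frac{\pi^3}{96}. \end{aligned} \] 4. If $n$ is even, then, with $N=\frac{n-2}{2}$, \[ \begin{aligned} S(n)={}&2+16\sum_{j=0}^{N}\frac{(j+1)(2H_{4j+3}-H_{2j+1})}{(4j+5)^2(4j+3)^2}+2\sum_{j=0}^{N}\frac{1}{(4j+5)^3}\\ &+8\sum_{k=0}^{N}\sum_{j=0}^{2k+1}\frac{(-1)^j(16k^2+32k+17)}{(2j+1)(4k+5)^2(4k+3)^2}\\ &-\left(1+\sum_{j=0}^{N}\frac{2(16j^2+32j+17)}{(4j+5)^2(4j+3)^2}\right)\pi\\ &+\left(\frac12-\sum_{j=0}^{N}\frac{1}{(4j+5)(4j+3)}\right)\frac{\pi^2}{3}-\frac{\pi^3}{96}. \end{aligned} \] -/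

import Mathlib

/-- The `k`-th term (`k ≥ 1`) of the series
`∑ (ψ((2k+2n+5)/4) - ψ((2k+2n+3)/4)) (1/2 - (-1)^k) / (2k)^2`, with `ψ` the digamma function. -/
noncomputable def digammaTerm (n k : ℕ) : ℂ :=
  (Complex.digamma ((2 * (k : ℂ) + 2 * (n : ℂ) + 5) / 4)
      - Complex.digamma ((2 * (k : ℂ) + 2 * (n : ℂ) + 3) / 4))
    * (1 / 2 - (-1 : ℂ) ^ k) / (2 * (k : ℂ)) ^ 2

/-- The series `∑_{k ≥ 1} digammaTerm n k` converges (absolutely), with sum the real number `s`. -/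
def DigammaSeriesHasSum (n : ℕ) (s : ℝ) : Prop :=
  HasSum (fun k : ℕ => digammaTerm n (k + 1)) (s : ℂ)

/-! Write G for `leibnizTail` and w_k = 1/2 - (-1)^k. Reflection at 1/4 and the recurrence of ψ give
ψ((2r+3)/4) - ψ((2r+1)/4) = 4G(r), so S(n) = T(n+1), where T(r) = ∑_{k≥1} G(k+r) w_k/k² is
`tailSeries`.

Since G(r) + G(r+1) = 1/(2r+1), also T(r) + T(r+1) = W(r) := ∑ w_k/(k²(2k+2r+1)). Partial fractions
evaluate W(r) through π², odd harmonic numbers O and G (`hasSum_weightedOddSum`); the weight w_k is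
what makes log 2 cancel. Only T(0) is then missing.

As T(r) → 0, the recurrence telescopes to T(0) = ∑ (-1)^j W(j). Leibniz's series handles the π²
part. The rest, ∑ (-1)^j (O(j+1) - 2G(j+1))/(2j+1)², is found by summing one absolutely convergent
double series along fibres and along antidiagonals: the unknown total cancels, leaving half of β(3)
= π³/32 (`hasSum_alternating_oddHarmonic_sub`). Hence T(0) = π³/24 - π³/32 = π³/96, and iterating
the recurrence two steps at a time gives the closed forms. -/

open Filter Topology Finset

/-! ### Tails of the Leibniz series -/

/-- The tail `∑_{m ≥ 0} (-1)^m / (2 r + 1 + 2 m)` of the Leibniz series, in integral form. -/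
noncomputable def leibnizTail (r : ℕ) : ℝ := ∫ x in (0 : ℝ)..1, x ^ (2 * r) * (1 + x ^ 2)⁻¹

lemma intervalIntegrable_leibnizTail (r : ℕ) :
    IntervalIntegrable (fun x : ℝ => x ^ (2 * r) * (1 + x ^ 2)⁻¹) MeasureTheory.volume 0 1 := by
  apply Continuous.intervalIntegrable
  refine (continuous_id.pow _).mul (Continuous.inv₀ (by fun_prop) fun x => ?_)
  positivity

lemma leibnizTail_zero : leibnizTail 0 = Real.pi / 4 := by
  simp [leibnizTail]

lemma leibnizTail_add_succ (r : ℕ) :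
    leibnizTail r + leibnizTail (r + 1) = 1 / (2 * r + 1) := by
  rw [leibnizTail, leibnizTail, ← intervalIntegral.integral_add
    (intervalIntegrable_leibnizTail r) (intervalIntegrable_leibnizTail (r + 1))]
  have h : ∀ x : ℝ, x ^ (2 * r) * (1 + x ^ 2)⁻¹ + x ^ (2 * (r + 1)) * (1 + x ^ 2)⁻¹
      = x ^ (2 * r) := by
    intro x
    have : (1 + x ^ 2) ≠ 0 := by positivity
    field_simp
    ring
  simp_rw [h]
  rw [integral_pow]
  simp

lemma leibnizTail_succ (r : ℕ) : leibnizTail (r + 1) = 1 / (2 * r + 1) - leibnizTail r := by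
  linarith [leibnizTail_add_succ r]

lemma leibnizTail_nonneg (r : ℕ) : 0 ≤ leibnizTail r := by
  apply intervalIntegral.integral_nonneg zero_le_one
  intro x hx
  have := hx.1
  positivity

lemma leibnizTail_le (r : ℕ) : leibnizTail r ≤ 1 / (2 * r + 1) := by
  linarith [leibnizTail_add_succ r, leibnizTail_nonneg (r + 1)]

lemma abs_leibnizTail_le (r : ℕ) : |leibnizTail r| ≤ 1 / (2 * r + 1) := by
  rw [abs_of_nonneg (leibnizTail_nonneg r)]
  exact leibnizTail_le r

lemma abs_leibnizTail_le_one (r : ℕ) : |leibnizTail r| ≤ 1 := by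
  refine (abs_leibnizTail_le r).trans ?_
  rw [div_le_one (by positivity)]
  linarith [(Nat.cast_nonneg r : (0 : ℝ) ≤ r)]

lemma tendsto_one_div_odd : Tendsto (fun r : ℕ => 1 / (2 * (r : ℝ) + 1)) atTop (𝓝 0) := by
  have h : Tendsto (fun r : ℕ => 2 * (r : ℝ) + 1) atTop atTop :=
    tendsto_atTop_add_const_right _ _
      (tendsto_natCast_atTop_atTop.const_mul_atTop (by norm_num))
  simpa [Pi.inv_def] using h.inv_tendsto_atTop

lemma tendsto_leibnizTail : Tendsto leibnizTail atTop (𝓝 0) :=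
  squeeze_zero leibnizTail_nonneg leibnizTail_le tendsto_one_div_odd

lemma sum_alternating_odd (r N : ℕ) :
    ∑ m ∈ range N, (-1 : ℝ) ^ m / (2 * ((r + m : ℕ) : ℝ) + 1)
      = leibnizTail r - (-1) ^ N * leibnizTail (r + N) := by
  induction N with
  | zero => simp
  | succ N ih =>
    rw [sum_range_succ, ih, ← add_assoc r N 1, leibnizTail_succ (r + N)]
    ring

lemma tendsto_sum_alternating_odd (r : ℕ) :
    Tendsto (fun N => ∑ m ∈ range N, (-1 : ℝ) ^ m / (2 * ((r + m : ℕ) : ℝ) + 1)) atTop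
      (𝓝 (leibnizTail r)) := by
  have h : Tendsto (fun N => (-1 : ℝ) ^ N * leibnizTail (r + N)) atTop (𝓝 0) := by
    apply squeeze_zero_norm (a := fun N => leibnizTail (N + r))
    · intro N
      simp [abs_of_nonneg (leibnizTail_nonneg _), add_comm]
    · exact (tendsto_add_atTop_iff_nat r).2 tendsto_leibnizTail
  simp_rw [sum_alternating_odd]
  simpa using h.const_sub (leibnizTail r)

lemma leibnizTail_eq (r : ℕ) :
    leibnizTail r = (-1) ^ r * (Real.pi / 4 - ∑ j ∈ range r, (-1 : ℝ) ^ j / (2 * (j : ℝ) + 1)) := by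
  have h := sum_alternating_odd 0 r
  simp only [zero_add, leibnizTail_zero] at h
  rw [h]
  have : ((-1 : ℝ) ^ r) * (-1) ^ r = 1 := by rw [← mul_pow]; norm_num
  linear_combination -leibnizTail r * this

/-! ### Digamma differences -/

/-- The reflection formula for the digamma function. -/
lemma digamma_one_sub_sub_digamma {s : ℂ} (hs : ∀ m : ℤ, s ≠ m) :
    Complex.digamma (1 - s) - Complex.digamma s
      = Real.pi * Complex.cos (Real.pi * s) / Complex.sin (Real.pi * s) := by
  have h1 : ∀ m : ℕ, s ≠ -m := fun m => by simpa using hs (-m)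
  have h2 : ∀ m : ℕ, 1 - s ≠ -m := fun m h => hs (m + 1) (by push_cast; linear_combination -h)
  have hpi : (Real.pi : ℂ) ≠ 0 := by simp [Real.pi_ne_zero]
  have hsin : Complex.sin (Real.pi * s) ≠ 0 := by
    rw [Complex.sin_ne_zero_iff]
    intro k hk
    apply hs k
    apply mul_left_cancel₀ hpi
    rw [hk, mul_comm]
  have hG1 := Complex.Gamma_ne_zero h1
  have hG2 := Complex.Gamma_ne_zero h2
  have hd1 : HasDerivAt Complex.Gamma (deriv Complex.Gamma s) s :=
    (Complex.differentiableAt_Gamma s h1).hasDerivAt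
  have hd2 : HasDerivAt (fun z => Complex.Gamma (1 - z)) (deriv Complex.Gamma (1 - s) * (-1)) s :=
    HasDerivAt.comp s (Complex.differentiableAt_Gamma _ h2).hasDerivAt
      ((hasDerivAt_id s).const_sub 1)
  have hd3 : HasDerivAt (fun z : ℂ => Complex.sin (Real.pi * z))
      (Complex.cos (Real.pi * s) * Real.pi) s := by
    simpa using ((hasDerivAt_id s).const_mul (Real.pi : ℂ)).csin
  have hd4 := hd3.inv hsin |>.const_mul (Real.pi : ℂ)
  have hd5 := hd1.mul hd2
  have heq : (Complex.Gamma * fun z => Complex.Gamma (1 - z))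
      = fun z => Real.pi * (Complex.sin (Real.pi * z))⁻¹ := by
    ext z
    simp only [Pi.mul_apply]
    rw [Complex.Gamma_mul_Gamma_one_sub, div_eq_mul_inv]
  rw [heq] at hd5
  have key := hd5.unique hd4
  have hprod := Complex.Gamma_mul_Gamma_one_sub s
  rw [Complex.digamma_def, logDeriv_apply, logDeriv_apply]
  rw [eq_div_iff hsin] at hprod
  have e1 : deriv Complex.Gamma (1 - s) / Complex.Gamma (1 - s)
      - deriv Complex.Gamma s / Complex.Gamma s
      = (deriv Complex.Gamma (1 - s) * Complex.Gamma s
        - deriv Complex.Gamma s * Complex.Gamma (1 - s))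
        / (Complex.Gamma s * Complex.Gamma (1 - s)) := by
    field_simp
  rw [e1, div_eq_div_iff (mul_ne_zero hG1 hG2) hsin]
  rw [← mul_div_assoc, eq_div_iff (pow_ne_zero 2 hsin)] at key
  apply mul_right_cancel₀ hsin
  linear_combination (-1 : ℂ) * key - Complex.cos (Real.pi * s) * Real.pi * hprod

lemma digamma_three_quarters_sub :
    Complex.digamma (3 / 4) - Complex.digamma (1 / 4) = Real.pi := by
  have h := digamma_one_sub_sub_digamma (s := 1 / 4) (fun m hm => by
    have h4 : ((4 * m : ℤ) : ℂ) = (1 : ℤ) := by push_cast; linear_combination -4 * hm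
    have := Int.cast_injective h4
    omega)
  have e : (1 - 1 / 4 : ℂ) = 3 / 4 := by norm_num
  have e2 : (Real.pi * (1 / 4) : ℂ) = ((Real.pi / 4 : ℝ) : ℂ) := by push_cast; ring
  rw [e, e2, ← Complex.ofReal_cos, ← Complex.ofReal_sin, Real.cos_pi_div_four,
    Real.sin_pi_div_four] at h
  rw [h, mul_div_assoc, div_self, mul_one]
  simp

/-- Both sides satisfy the same first-order recurrence in r, by ψ(z+1) = ψ(z) + 1/z; the case r = 0
is reflection at 1/4. -/
lemma digamma_sub_eq_leibnizTail (r : ℕ) :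
    Complex.digamma ((2 * (r : ℂ) + 3) / 4) - Complex.digamma ((2 * (r : ℂ) + 1) / 4)
      = ((4 * leibnizTail r : ℝ) : ℂ) := by
  induction r with
  | zero =>
    rw [leibnizTail_zero]
    have := digamma_three_quarters_sub
    simp only [Nat.cast_zero, mul_zero, zero_add]
    rw [this]
    push_cast
    ring
  | succ r ih =>
    have h : ∀ m : ℕ, (2 * (r : ℂ) + 1) / 4 ≠ -m := by
      intro m hm
      have h4 : ((2 * r + 1 + 4 * m : ℕ) : ℂ) = (0 : ℕ) := by
        push_cast; linear_combination 4 * hm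
      have := Nat.cast_injective h4
      omega
    have e1 : (2 * ((r + 1 : ℕ) : ℂ) + 3) / 4 = (2 * (r : ℂ) + 1) / 4 + 1 := by push_cast; ring
    have e2 : (2 * ((r + 1 : ℕ) : ℂ) + 1) / 4 = (2 * (r : ℂ) + 3) / 4 := by push_cast; ring
    rw [e1, e2, Complex.digamma_apply_add_one _ h, leibnizTail_succ]
    push_cast at ih ⊢
    rw [inv_div]
    linear_combination -ih

lemma hasSum_congr_terms {ι : Type*} {f g : ι → ℝ} {a : ℝ} (h : ∀ i, f i = g i) :
    HasSum f a ↔ HasSum g a := by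
  rw [funext h]

/-! ### Odd and alternating harmonic sums -/

/-- The sum of the reciprocals of the first `r` odd numbers. -/
noncomputable def oddHarmonic (r : ℕ) : ℝ := ∑ i ∈ range r, 1 / (2 * (i : ℝ) + 1)

lemma oddHarmonic_zero : oddHarmonic 0 = 0 := by simp [oddHarmonic]

lemma oddHarmonic_succ (r : ℕ) : oddHarmonic (r + 1) = oddHarmonic r + 1 / (2 * r + 1) :=
  sum_range_succ _ _

lemma cast_harmonic_succ (n : ℕ) : (harmonic (n + 1) : ℝ) = harmonic n + 1 / (n + 1) := by
  rw [harmonic_succ]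
  push_cast
  rw [one_div]

lemma harmonic_two_mul_sub (r : ℕ) :
    (harmonic (2 * r) : ℝ) - harmonic r / 2 = oddHarmonic r := by
  induction r with
  | zero => simp [oddHarmonic_zero]
  | succ r ih =>
    rw [oddHarmonic_succ, ← ih, show 2 * (r + 1) = 2 * r + 1 + 1 by ring, cast_harmonic_succ,
      cast_harmonic_succ, cast_harmonic_succ]
    push_cast
    field_simp
    ring

lemma oddHarmonic_succ_eq (r : ℕ) :
    oddHarmonic (r + 1) = (harmonic (2 * r + 1) : ℝ) - harmonic r / 2 := by
  rw [oddHarmonic_succ, ← harmonic_two_mul_sub, cast_harmonic_succ]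
  push_cast
  ring

lemma sum_alternating_two_mul (n : ℕ) :
    ∑ k ∈ range (2 * n), (-1 : ℝ) ^ k / ((k : ℝ) + 1) = harmonic (2 * n) - harmonic n := by
  induction n with
  | zero => simp
  | succ r ih =>
    rw [show 2 * (r + 1) = 2 * r + 1 + 1 by ring, sum_range_succ, sum_range_succ, ih,
      cast_harmonic_succ, cast_harmonic_succ, cast_harmonic_succ]
    have : (-1 : ℝ) ^ (2 * r) = 1 := by simp
    rw [pow_succ, this]
    push_cast
    field_simp
    ring

lemma sum_alternating_two_mul_add_one (n : ℕ) :
    ∑ k ∈ range (2 * n + 1), (-1 : ℝ) ^ k / ((k : ℝ) + 1)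
      = harmonic (2 * n + 1) - harmonic n := by
  rw [sum_range_succ, sum_alternating_two_mul, cast_harmonic_succ]
  have : (-1 : ℝ) ^ (2 * n) = 1 := by simp
  rw [this]
  push_cast
  ring

/-! ### Weighted series over k -/

lemma hasSum_weight_div_sq :
    HasSum (fun k : ℕ => (1 / 2 - (-1 : ℝ) ^ (k + 1)) / ((k : ℝ) + 1) ^ 2) (Real.pi ^ 2 / 6) := by
  have hz := hasSum_zeta_two
  have he : HasSum (fun n : ℕ => if Even n then (1 : ℝ) / (n : ℝ) ^ 2 else 0)
      (Real.pi ^ 2 / 6 / 4) := by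
    have hinj : Function.Injective (fun n : ℕ => 2 * n) := fun a b h => by simpa using h
    rw [← hinj.hasSum_iff]
    · refine (hasSum_congr_terms fun n => ?_).2 (hz.div_const 4)
      simp only [Function.comp_apply, even_two, Even.mul_right, if_true]
      push_cast
      rw [mul_pow, div_div]
      norm_num [mul_comm]
    · intro x hx
      rw [if_neg]
      rintro ⟨y, hy⟩
      exact hx ⟨y, by simp only []; omega⟩
  -- The weight is 3/2 at odd k and -1/2 = 3/2 - 2 at even k.
  have h := (hz.mul_left (3 / 2)).sub (he.mul_left 2)
  have h' : HasSum (fun n : ℕ => (1 / 2 - (-1 : ℝ) ^ n) / (n : ℝ) ^ 2) (Real.pi ^ 2 / 6) := by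
    rw [show Real.pi ^ 2 / 6 = 3 / 2 * (Real.pi ^ 2 / 6) - 2 * (Real.pi ^ 2 / 6 / 4) by ring]
    refine (hasSum_congr_terms fun n => ?_).2 h
    · rcases Nat.even_or_odd n with hn | hn
      · rw [if_pos hn, hn.neg_one_pow]
        ring
      · rw [if_neg (Nat.not_even_iff_odd.2 hn), hn.neg_one_pow]
        ring
  rw [← hasSum_nat_add_iff' 1] at h'
  simpa using h'

lemma abs_weight_le (k : ℕ) : |1 / 2 - (-1 : ℝ) ^ k| ≤ 3 / 2 := by
  rcases neg_one_pow_eq_or ℝ k with h | h <;> rw [h] <;> norm_num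

lemma summable_one_div_succ_sq : Summable (fun k : ℕ => 1 / ((k : ℝ) + 1) ^ 2) := by
  have := (summable_nat_add_iff 1).2 hasSum_zeta_two.summable
  simpa using this

lemma summable_mul_weight_div_sq {g : ℕ → ℝ} (hg : ∀ k, |g k| ≤ 1) :
    Summable (fun k : ℕ => g k * (1 / 2 - (-1 : ℝ) ^ (k + 1)) / ((k : ℝ) + 1) ^ 2) := by
  refine Summable.of_norm_bounded (summable_one_div_succ_sq.mul_left (3 / 2)) fun k => ?_
  rw [Real.norm_eq_abs, abs_div, abs_mul, abs_of_pos (by positivity : (0 : ℝ) < ((k : ℝ) + 1) ^ 2),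
    mul_one_div]
  gcongr
  calc |g k| * |1 / 2 - (-1 : ℝ) ^ (k + 1)| ≤ 1 * (3 / 2) :=
        mul_le_mul (hg k) (abs_weight_le _) (abs_nonneg _) zero_le_one
    _ = 3 / 2 := one_mul _

lemma tendsto_mul_add_atTop (a b : ℕ) (ha : 0 < a) :
    Tendsto (fun n : ℕ => a * n + b) atTop atTop :=
  tendsto_atTop_mono (fun n => (Nat.le_mul_of_pos_left n ha).trans (Nat.le_add_right _ b)) tendsto_id

/-- The first two terms tend to -log 2 and the bracket to log 2. With every term written as H_m -
log m, the multiples of γ cancel and the logarithms leave (log 2 - log((2n+r)/n))/2. -/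
lemma tendsto_harmonic_combination (r : ℕ) :
    Tendsto (fun n : ℕ => (harmonic (2 * n) : ℝ) / 2 - oddHarmonic (2 * n + r)
      + (harmonic (2 * n) - harmonic n)) atTop (𝓝 0) := by
  have h := Real.tendsto_harmonic_sub_log
  have h1 := h.comp (tendsto_mul_add_atTop 2 0 two_pos)
  have h2 := h.comp (tendsto_mul_add_atTop 4 (2 * r) (by norm_num))
  have h3 := h.comp (tendsto_mul_add_atTop 2 r two_pos)
  have hq : Tendsto (fun n : ℕ => ((2 * n + r : ℕ) : ℝ) / n) atTop (𝓝 2) := by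
    have := (tendsto_const_div_atTop_nhds_zero_nat (r : ℝ)).const_add 2
    rw [add_zero] at this
    refine this.congr' ?_
    filter_upwards [eventually_gt_atTop 0] with n hn
    have : (n : ℝ) ≠ 0 := by positivity
    push_cast
    field_simp
  have hl := hq.log two_ne_zero
  have hsum := (((h1.mul_const (3 / 2)).sub h2).add (h3.div_const 2)).sub h |>.add
    ((hl.const_sub (Real.log 2)).div_const 2)
  have hlim : Real.eulerMascheroniConstant * (3 / 2) - Real.eulerMascheroniConstant
      + Real.eulerMascheroniConstant / 2 - Real.eulerMascheroniConstant
      + (Real.log 2 - Real.log 2) / 2 = 0 := by ring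
  rw [hlim] at hsum
  refine hsum.congr' ?_
  filter_upwards [eventually_gt_atTop 0] with n hn
  have hn' : (n : ℝ) ≠ 0 := by positivity
  have hm' : ((2 * n + r : ℕ) : ℝ) ≠ 0 := by positivity
  have e4 : 4 * n + 2 * r = 2 * (2 * n + r) := by ring
  simp only [Function.comp_apply, add_zero]
  rw [Real.log_div hm' hn', e4, ← harmonic_two_mul_sub]
  rw [Nat.cast_mul 2 (2 * n + r), Real.log_mul (by norm_num) hm', Nat.cast_mul 2 n,
    Real.log_mul (by norm_num) hn']
  push_cast
  ring

lemma sum_one_div_odd_shift (r N : ℕ) :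
    ∑ k ∈ range N, 1 / (2 * ((k : ℝ) + 1 + r) + 1) 
      = oddHarmonic (N + (r + 1)) - oddHarmonic (r + 1) := by
  induction N with
  | zero => simp
  | succ N ih =>
    rw [sum_range_succ, ih, show N + 1 + (r + 1) = N + (r + 1) + 1 by ring,
      oddHarmonic_succ (N + (r + 1))]
    push_cast
    ring

lemma sum_weight_mul_sub (r N : ℕ) :
    ∑ k ∈ range N, (1 / 2 - (-1 : ℝ) ^ (k + 1)) *
      (1 / ((k : ℝ) + 1) - 2 / (2 * ((k : ℝ) + 1 + r) + 1))
    = (∑ k ∈ range N, 1 / ((k : ℝ) + 1)) / 2 - ∑ k ∈ range N, 1 / (2 * ((k : ℝ) + 1 + r) + 1)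
      + ∑ k ∈ range N, (-1 : ℝ) ^ k / ((k : ℝ) + 1)
      - 2 * ∑ m ∈ range N, (-1 : ℝ) ^ m / (2 * ((r + 1 + m : ℕ) : ℝ) + 1) := by
  induction N with
  | zero => simp
  | succ N ih =>
    simp only [sum_range_succ, ih]
    push_cast
    ring

/-- Summation of `(1/2 - (-1)^k) (1/k - 2/(2k+2r+1))` over `k ≥ 1`. -/
lemma hasSum_weight_mul_sub (r : ℕ) :
    HasSum (fun k : ℕ => (1 / 2 - (-1 : ℝ) ^ (k + 1)) *
      (1 / ((k : ℝ) + 1) - 2 / (2 * ((k : ℝ) + 1 + r) + 1)))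
      (oddHarmonic (r + 1) - 2 * leibnizTail (r + 1)) := by
  have hs : Summable (fun k : ℕ => (1 / 2 - (-1 : ℝ) ^ (k + 1)) *
      (1 / ((k : ℝ) + 1) - 2 / (2 * ((k : ℝ) + 1 + r) + 1))) := by
    have := (summable_mul_weight_div_sq (g := fun k => (k + 1) / (2 * ((k : ℝ) + 1 + r) + 1))
      (fun k => by
        rw [abs_of_nonneg (by positivity), div_le_one (by positivity)]
        linarith [(Nat.cast_nonneg r : (0 : ℝ) ≤ r), (Nat.cast_nonneg k : (0 : ℝ) ≤ k)])).mul_left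
      (2 * r + 1 : ℝ)
    refine this.congr fun k => ?_
    have : 2 * ((k : ℝ) + 1 + r) + 1 ≠ 0 := by positivity
    field_simp
    ring
  -- Summability being known, partial sums of even length suffice; there the alternating harmonic
  -- sum is H_{2n} - H_n.
  have ht := hs.hasSum.tendsto_sum_nat.comp (tendsto_mul_add_atTop 2 0 two_pos)
  have h1 := (tendsto_harmonic_combination (r + 1)).add_const (oddHarmonic (r + 1))
  have h2 := h1.sub (((tendsto_sum_alternating_odd (r + 1)).comp
    (tendsto_mul_add_atTop 2 0 two_pos)).const_mul 2)
  rw [zero_add] at h2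
  have : ∑' k : ℕ, (1 / 2 - (-1 : ℝ) ^ (k + 1)) *
      (1 / ((k : ℝ) + 1) - 2 / (2 * ((k : ℝ) + 1 + r) + 1))
      = oddHarmonic (r + 1) - 2 * leibnizTail (r + 1) := by
    refine tendsto_nhds_unique ht (h2.congr fun n => ?_)
    simp only [Function.comp_apply, add_zero]
    rw [← sum_alternating_two_mul]
    have hH : (harmonic (2 * n) : ℝ) = ∑ k ∈ range (2 * n), 1 / ((k : ℝ) + 1) := by
      simp [harmonic]
    rw [hH]
    have hO := sum_one_div_odd_shift r (2 * n)
    have hO' : oddHarmonic (2 * n + (r + 1))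
      = ∑ k ∈ range (2 * n), 1 / (2 * ((k : ℝ) + 1 + r) + 1) + oddHarmonic (r + 1) := by linarith
    rw [hO', sum_weight_mul_sub]
    ring
  rw [← this]
  exact hs.hasSum

/-- The closed form of `∑_{k ≥ 1} (1/2 - (-1)^k) / (k^2 (2k+2r+1))`. -/
noncomputable def weightedOddSum (r : ℕ) : ℝ :=
  Real.pi ^ 2 / 6 / (2 * r + 1)
    - 2 / (2 * r + 1) ^ 2 * (oddHarmonic (r + 1) - 2 * leibnizTail (r + 1))

lemma hasSum_weightedOddSum (r : ℕ) :
    HasSum (fun k : ℕ => 1 / (2 * ((k : ℝ) + 1 + r) + 1) * (1 / 2 - (-1 : ℝ) ^ (k + 1))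
      / ((k : ℝ) + 1) ^ 2) (weightedOddSum r) := by
  have h := (hasSum_weight_div_sq.div_const (2 * (r : ℝ) + 1)).sub
    ((hasSum_weight_mul_sub r).mul_left (2 / (2 * (r : ℝ) + 1) ^ 2))
  refine (hasSum_congr_terms fun k => ?_).2 h
  have h1 : 2 * ((k : ℝ) + 1 + r) + 1 ≠ 0 := by positivity
  have h2 : (2 * (r : ℝ) + 1) ≠ 0 := by positivity
  have h3 : (k : ℝ) + 1 ≠ 0 := by positivity
  generalize (1 / 2 - (-1 : ℝ) ^ (k + 1)) = c
  field_simp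
  ring

/-! ### The tail series and its recurrence -/

/-- The sum `∑_{k ≥ 1} G (k + r) (1/2 - (-1)^k) / k^2` where `G` is `leibnizTail`. -/
noncomputable def tailSeries (r : ℕ) : ℝ :=
  ∑' k : ℕ, leibnizTail (k + 1 + r) * (1 / 2 - (-1 : ℝ) ^ (k + 1)) / ((k : ℝ) + 1) ^ 2

lemma hasSum_tailSeries (r : ℕ) :
    HasSum (fun k : ℕ => leibnizTail (k + 1 + r) * (1 / 2 - (-1 : ℝ) ^ (k + 1))
      / ((k : ℝ) + 1) ^ 2) (tailSeries r) :=
  (summable_mul_weight_div_sq fun _ => abs_leibnizTail_le_one _).hasSum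

lemma tailSeries_succ (r : ℕ) : tailSeries (r + 1) = weightedOddSum r - tailSeries r := by
  have h := (hasSum_tailSeries r).add (hasSum_tailSeries (r + 1))
  have h' := hasSum_weightedOddSum r
  have e : tailSeries r + tailSeries (r + 1) = weightedOddSum r := by
    refine h.unique ((hasSum_congr_terms fun k => ?_).2 h')
    rw [← add_div, ← add_mul, ← add_assoc, leibnizTail_add_succ]
    push_cast
    rfl
  linarith

lemma tendsto_tailSeries : Tendsto tailSeries atTop (𝓝 0) := by
  have h := tendsto_one_div_odd.mul_const (∑' k : ℕ, 3 / 2 * (1 / ((k : ℝ) + 1) ^ 2))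
  rw [zero_mul] at h
  refine squeeze_zero_norm (fun r => ?_) h
  rw [← tsum_mul_left]
  refine tsum_of_norm_bounded
    ((summable_one_div_succ_sq.mul_left (3 / 2)).mul_left (1 / (2 * (r : ℝ) + 1))).hasSum
    fun k => ?_
  rw [Real.norm_eq_abs, abs_div, abs_mul, abs_of_pos (by positivity : (0 : ℝ) < ((k : ℝ) + 1) ^ 2),
    mul_one_div, mul_div_assoc]
  gcongr
  · refine (abs_leibnizTail_le _).trans ?_
    gcongr
    linarith [(Nat.cast_nonneg k : (0 : ℝ) ≤ k)]
  · exact abs_weight_le _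

/-! ### A double series summed in two ways -/

lemma hasSum_dirichlet_beta_three :
    HasSum (fun j : ℕ => (-1 : ℝ) ^ j / (2 * (j : ℝ) + 1) ^ 3) (Real.pi ^ 3 / 32) := by
  have h := hasSum_L_function_mod_four_eval_three
  have hinj : Function.Injective (fun n : ℕ => 2 * n + 1) := fun a b h => by simpa using h
  rw [← hinj.hasSum_iff] at h
  · refine (hasSum_congr_terms fun j => ?_).1 h
    simp only [Function.comp_apply]
    have : Real.pi * ((2 * j + 1 : ℕ) : ℝ) / 2 = j * Real.pi + Real.pi / 2 := by
      push_cast; ring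
    rw [this, Real.sin_add_pi_div_two, Real.cos_nat_mul_pi]
    push_cast
    ring
  · intro n hn
    have he : Even n := by
      by_contra ho
      obtain ⟨k, hk⟩ := Nat.not_even_iff_odd.1 ho
      exact hn ⟨k, hk.symm⟩
    obtain ⟨k, rfl⟩ := he
    have : Real.pi * ((k + k : ℕ) : ℝ) / 2 = k * Real.pi := by push_cast; ring
    rw [this, Real.sin_nat_mul_pi, mul_zero]

/-- With `b = 2 j + 1` and `a = b + 2 (m + 1)`, this is `χ(a) / (a (a^2 - b^2))`, where `χ` is the
nontrivial character modulo `4`. -/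
noncomputable def oddPairTerm (p : ℕ × ℕ) : ℝ :=
  (-1) ^ (p.1 + p.2 + 1) / ((2 * ((p.1 : ℝ) + p.2) + 3) * (4 * (p.2 + 1) * (2 * p.1 + p.2 + 2)))

/-- With x = j+1 and y = m+1 the right side is the denominator of `oddPairTerm`, so a product of two
convergent p-series with p = 3/2 dominates. The core is √x√y ≤ x + y. -/
lemma rpow_mul_rpow_le (x y : ℝ) (hx : 1 ≤ x) (hy : 1 ≤ y) :
    x ^ (3 / 2 : ℝ) * y ^ (3 / 2 : ℝ) ≤ (2 * x + 2 * y - 1) * (4 * y * (2 * x + y - 1)) := by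
  have hx0 : 0 < x := by linarith
  have hy0 : 0 < y := by linarith
  have e : ∀ z : ℝ, 0 < z → z ^ (3 / 2 : ℝ) = z * √z := by
    intro z hz
    rw [show (3 / 2 : ℝ) = 1 + 1 / 2 by norm_num, Real.rpow_add hz, Real.rpow_one,
      ← Real.sqrt_eq_rpow]
  rw [e x hx0, e y hy0]
  have h1 : √x * √y ≤ x + y := by
    nlinarith [Real.sq_sqrt hx0.le, Real.sq_sqrt hy0.le, sq_nonneg (√x - √y),
      Real.sqrt_nonneg x, Real.sqrt_nonneg y]
  calc x * √x * (y * √y) = x * y * (√x * √y) := by ring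
    _ ≤ x * y * (x + y) := by gcongr
    _ ≤ (2 * x + 2 * y - 1) * (4 * y * (2 * x + y - 1)) := by
      have : x * (x + y) ≤ (2 * x + 2 * y - 1) * (4 * (2 * x + y - 1)) := by
        apply mul_le_mul <;> linarith
      nlinarith

lemma summable_oddPairTerm : Summable oddPairTerm := by
  have hp : Summable (fun n : ℕ => 1 / ((n : ℝ) + 1) ^ (3 / 2 : ℝ)) := by
    have h := (summable_nat_add_iff 1).2
      (Real.summable_one_div_nat_rpow.2 (by norm_num : (1 : ℝ) < 3 / 2))
    simpa using h
  have hpp := hp.mul_of_nonneg hp (fun n => by simp only [Pi.zero_apply]; positivity)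
    (fun n => by simp only [Pi.zero_apply]; positivity)
  refine Summable.of_norm_bounded hpp fun p => ?_
  have h := rpow_mul_rpow_le ((p.1 : ℝ) + 1) ((p.2 : ℝ) + 1) (by simp) (by simp)
  rw [oddPairTerm, Real.norm_eq_abs, abs_div, abs_pow, abs_neg, abs_one, one_pow,
    abs_of_pos (by positivity), one_div_mul_one_div]
  apply one_div_le_one_div_of_le (by positivity)
  refine h.trans (le_of_eq ?_)
  ring

lemma sum_one_div_add (n : ℕ) :
    ∑ j ∈ range (n + 1), 1 / ((n : ℝ) + j + 2) = harmonic (2 * n + 2) - harmonic (n + 1) := by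
  have h : ∀ N : ℕ, ∑ j ∈ range N, 1 / ((n : ℝ) + j + 2)
      = harmonic (n + 1 + N) - harmonic (n + 1) := by
    intro N
    induction N with
    | zero => simp
    | succ N ih =>
      rw [sum_range_succ, ih, ← add_assoc, cast_harmonic_succ (n + 1 + N)]
      push_cast
      ring
  rw [h, show n + 1 + (n + 1) = 2 * n + 2 by ring]

lemma sum_one_div_reflect (n : ℕ) :
    ∑ j ∈ range (n + 1), 1 / ((n : ℝ) - j + 1) = harmonic (n + 1) := by
  rw [← sum_range_reflect]
  simp only [harmonic]
  push_cast
  refine sum_congr rfl fun j hj => ?_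
  have : j ≤ n := Nat.lt_succ_iff.1 (mem_range.1 hj)
  rw [Nat.cast_sub this, one_div]
  congr 1
  ring

/-- Here a = 2n+3 is fixed and 1/(a²-b²) = (1/(a-b) + 1/(a+b))/(2a). The two parts contribute
H_{n+1} and H_{2n+2} - H_{n+1}, which join up to a single harmonic number. -/
lemma sum_antidiagonal_oddPairTerm (n : ℕ) :
    ∑ p ∈ antidiagonal n, oddPairTerm p
      = (-1) ^ (n + 1) * (harmonic (2 * (n + 1)) : ℝ) / (4 * (2 * ((n + 1 : ℕ) : ℝ) + 1) ^ 2) := by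
  rw [Nat.sum_antidiagonal_eq_sum_range_succ_mk]
  have h : ∀ j ∈ range (n + 1), oddPairTerm (j, n - j)
      = (-1) ^ (n + 1) / (4 * (2 * (n : ℝ) + 3) ^ 2)
        * (1 / ((n : ℝ) - j + 1) + 1 / ((n : ℝ) + j + 2)) := by
    intro j hj
    obtain ⟨m, rfl⟩ := Nat.exists_eq_add_of_le (Nat.lt_succ_iff.1 (mem_range.1 hj))
    rw [oddPairTerm]
    simp only [Nat.add_sub_cancel_left]
    push_cast
    have e : ((j : ℝ) + m - j + 1) = m + 1 := by ring
    rw [e]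
    have h1 : (j : ℝ) + m + j + 2 = 2 * j + m + 2 := by ring
    rw [h1]
    field_simp
    ring
  rw [sum_congr rfl h, ← mul_sum, sum_add_distrib, sum_one_div_reflect, sum_one_div_add,
    show 2 * (n + 1) = 2 * n + 2 by ring]
  push_cast
  ring

/-- Here b is fixed and 1/(a(a²-b²)) = ((1/(a-b) + 1/(a+b))/2 - 1/a)/b². The first two parts are
alternating harmonic series shifted by the odd amount 2j+1, so they enter with opposite signs and
their common limit drops out; the third is a Leibniz tail. -/
lemma hasSum_oddPairTerm_fiber (j : ℕ) :
    HasSum (fun m => oddPairTerm (j, m))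
      ((-1) ^ j / (2 * (j : ℝ) + 1) ^ 2
        * (((harmonic j : ℝ) - harmonic (2 * j + 1)) / 4 + leibnizTail (j + 1))) := by
  have hs : Summable (fun m => oddPairTerm (j, m)) := summable_oddPairTerm.prod_factor j
  set A : ℕ → ℝ := fun n => ∑ k ∈ range n, (-1 : ℝ) ^ k / ((k : ℝ) + 1) with hA
  have hAs : ∀ n, A (n + 1) = A n + (-1 : ℝ) ^ n / ((n : ℝ) + 1) := fun n => sum_range_succ _ _
  have hpartial : ∀ M, ∑ m ∈ range M, oddPairTerm (j, m)
      = (-1) ^ j / (2 * (j : ℝ) + 1) ^ 2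
        * ((A (M + (2 * j + 1)) - A M - A (2 * j + 1)) / 4
          + ∑ m ∈ range M, (-1 : ℝ) ^ m / (2 * ((j + 1 + m : ℕ) : ℝ) + 1)) := by
    intro M
    induction M with
    | zero => simp [hA]
    | succ M ih =>
      rw [sum_range_succ, ih, sum_range_succ, hAs M,
        show M + 1 + (2 * j + 1) = M + (2 * j + 1) + 1 by ring, hAs (M + (2 * j + 1)), oddPairTerm]
      have e1 : (-1 : ℝ) ^ (M + (2 * j + 1)) = -(-1) ^ M := by
        rw [pow_add, pow_succ, pow_mul]; norm_num
      have e2 : (-1 : ℝ) ^ (j + M + 1) = -((-1) ^ j * (-1) ^ M) := by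
        rw [pow_succ, pow_add]; ring
      simp only [e1, e2]
      push_cast
      have h1 : (M : ℝ) + (2 * j + 1) + 1 = 2 * j + M + 2 := by ring
      have h2 : 2 * ((j : ℝ) + 1 + M) + 1 = 2 * (j + M) + 3 := by ring
      rw [h1, h2]
      field_simp
      ring
  have hconv : ∃ l, Tendsto A atTop (𝓝 l) := by
    have hanti : Antitone (fun k : ℕ => 1 / ((k : ℝ) + 1)) := fun a b hab =>
      one_div_le_one_div_of_le (by positivity) (by gcongr)
    obtain ⟨l, hl⟩ := hanti.tendsto_alternating_series_of_tendsto_zero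
      tendsto_one_div_add_atTop_nhds_zero_nat
    exact ⟨l, by simpa [hA, div_eq_mul_inv] using hl⟩
  obtain ⟨l, hl⟩ := hconv
  have hlim := (((((tendsto_add_atTop_iff_nat (2 * j + 1)).2 hl).sub hl).sub_const
    (A (2 * j + 1))).div_const 4 |>.add (tendsto_sum_alternating_odd (j + 1))).const_mul
      ((-1) ^ j / (2 * (j : ℝ) + 1) ^ 2)
  have := tendsto_nhds_unique hs.hasSum.tendsto_sum_nat (hlim.congr fun M => (hpartial M).symm)
  have hAj : A (2 * j + 1) = harmonic (2 * j + 1) - harmonic j := sum_alternating_two_mul_add_one j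
  rw [hAj, sub_self, zero_sub, neg_sub] at this
  rw [← this]
  exact hs.hasSum

lemma hasSum_alternating_oddHarmonic_sub :
    HasSum (fun j : ℕ => (-1 : ℝ) ^ j / (2 * (j : ℝ) + 1) ^ 2
      * (oddHarmonic (j + 1) - 2 * leibnizTail (j + 1))) (Real.pi ^ 3 / 64) := by
  have h1 := summable_oddPairTerm.hasSum.prod_fiberwise hasSum_oddPairTerm_fiber
  have h2 := ((HasAntidiagonal.sigmaAntidiagonalEquivProd (A := ℕ)).hasSum_iff.2
    summable_oddPairTerm.hasSum).sigma (fun n => (hasSum_fintype _))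
  have h3 : HasSum (fun n : ℕ => (-1) ^ (n + 1) * (harmonic (2 * (n + 1)) : ℝ)
      / (4 * (2 * ((n + 1 : ℕ) : ℝ) + 1) ^ 2)) (∑' p, oddPairTerm p) := by
    refine (hasSum_congr_terms fun n => ?_).1 h2
    rw [← sum_antidiagonal_oddPairTerm]
    exact sum_coe_sort (antidiagonal n) oddPairTerm
  have h4 : HasSum (fun n : ℕ => (-1) ^ n * (harmonic (2 * n) : ℝ)
      / (4 * (2 * (n : ℝ) + 1) ^ 2)) (∑' p, oddPairTerm p) := by
    rw [← hasSum_nat_add_iff' 1]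
    simpa using h3
  -- The double sum cancels. Half of β(3) completes the bracket: H_{2j}/2 + 1/(2(2j+1)) =
  -- H_{2j+1}/2, and H_{2j+1} - H_j/2 = O(j+1).
  have h5 := ((h4.mul_left 2).sub (h1.mul_left 2)).add (hasSum_dirichlet_beta_three.mul_left (1 / 2))
  rw [sub_self, zero_add, show 1 / 2 * (Real.pi ^ 3 / 32) = Real.pi ^ 3 / 64 by ring] at h5
  refine (hasSum_congr_terms fun j => ?_).1 h5
  rw [oddHarmonic_succ_eq, cast_harmonic_succ]
  push_cast
  field_simp
  ring

/-! ### The initial value and the link with the digamma series -/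

lemma tailSeries_zero : tailSeries 0 = Real.pi ^ 3 / 96 := by
  have hpartial : ∀ N, ∑ j ∈ range N, (-1 : ℝ) ^ j * weightedOddSum j
      = tailSeries 0 - (-1) ^ N * tailSeries N := by
    intro N
    induction N with
    | zero => simp
    | succ N ih =>
      rw [sum_range_succ, ih, tailSeries_succ]
      ring
  have h0 : Tendsto (fun N => (-1 : ℝ) ^ N * tailSeries N) atTop (𝓝 0) := by
    rw [tendsto_zero_iff_norm_tendsto_zero]
    simpa using tendsto_tailSeries.norm
  have h1 : Tendsto (fun N => ∑ j ∈ range N, (-1 : ℝ) ^ j * weightedOddSum j) atTop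
      (𝓝 (tailSeries 0)) := by
    simp_rw [hpartial]
    simpa using h0.const_sub (tailSeries 0)
  have h2 := ((tendsto_sum_alternating_odd 0).const_mul (Real.pi ^ 2 / 6)).sub
    (hasSum_alternating_oddHarmonic_sub.tendsto_sum_nat.const_mul 2)
  rw [leibnizTail_zero] at h2
  rw [tendsto_nhds_unique h1 (h2.congr fun N => ?_)]
  · ring
  · rw [mul_sum, mul_sum, ← sum_sub_distrib]
    refine sum_congr rfl fun j _ => ?_
    rw [weightedOddSum, zero_add]
    ring

lemma digammaTerm_succ (n k : ℕ) :
    digammaTerm n (k + 1) = ((leibnizTail (k + 1 + (n + 1)) * (1 / 2 - (-1 : ℝ) ^ (k + 1))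
      / ((k : ℝ) + 1) ^ 2 : ℝ) : ℂ) := by
  have h := digamma_sub_eq_leibnizTail (k + 1 + (n + 1))
  have e1 : (2 * ((k + 1 : ℕ) : ℂ) + 2 * (n : ℂ) + 5) / 4
      = (2 * ((k + 1 + (n + 1) : ℕ) : ℂ) + 3) / 4 := by push_cast; ring
  have e2 : (2 * ((k + 1 : ℕ) : ℂ) + 2 * (n : ℂ) + 3) / 4
      = (2 * ((k + 1 + (n + 1) : ℕ) : ℂ) + 1) / 4 := by push_cast; ring
  rw [digammaTerm, e1, e2, h]
  have : (k : ℂ) + 1 ≠ 0 := Nat.cast_add_one_ne_zero k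
  push_cast
  field_simp
  ring

lemma digammaSeriesHasSum_tailSeries (n : ℕ) : DigammaSeriesHasSum n (tailSeries (n + 1)) := by
  rw [DigammaSeriesHasSum]
  simp_rw [digammaTerm_succ]
  exact Complex.hasSum_ofReal.2 (hasSum_tailSeries (n + 1))

/-! ### Rationality of the coefficients and closed forms -/

lemma exists_rat_oddHarmonic (r : ℕ) : ∃ q : ℚ, oddHarmonic r = q :=
  ⟨∑ i ∈ range r, 1 / (2 * (i : ℚ) + 1), by simp [oddHarmonic]⟩

lemma exists_rat_leibnizTail (r : ℕ) : ∃ p q : ℚ, leibnizTail r = p + q * Real.pi := by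
  refine ⟨-((-1) ^ r * ∑ j ∈ range r, (-1 : ℚ) ^ j / (2 * (j : ℚ) + 1)), (-1) ^ r / 4, ?_⟩
  rw [leibnizTail_eq]
  push_cast
  ring

lemma exists_rat_tailSeries (r : ℕ) : ∃ a₀ a₁ a₂ a₃ : ℚ, tailSeries r
    = (a₀ : ℝ) + (a₁ : ℝ) * Real.pi + (a₂ : ℝ) * Real.pi ^ 2 + (a₃ : ℝ) * Real.pi ^ 3 := by
  induction r with
  | zero => exact ⟨0, 0, 0, 1 / 96, by rw [tailSeries_zero]; push_cast; ring⟩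
  | succ r ih =>
    obtain ⟨a₀, a₁, a₂, a₃, h⟩ := ih
    obtain ⟨o, ho⟩ := exists_rat_oddHarmonic (r + 1)
    obtain ⟨p, q, hpq⟩ := exists_rat_leibnizTail (r + 1)
    refine ⟨-2 / (2 * r + 1) ^ 2 * (o - 2 * p) - a₀, 4 / (2 * r + 1) ^ 2 * q - a₁,
      1 / 6 / (2 * r + 1) - a₂, -a₃, ?_⟩
    rw [tailSeries_succ, weightedOddSum, h, ho, hpq]
    push_cast
    ring

lemma tailSeries_one : tailSeries 1
    = 2 - Real.pi + Real.pi ^ 2 / 6 - Real.pi ^ 3 / 96 := by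
  rw [tailSeries_succ, tailSeries_zero, weightedOddSum, leibnizTail_succ, leibnizTail_zero,
    oddHarmonic_succ, oddHarmonic_zero]
  norm_num
  ring

lemma tailSeries_two : tailSeries 2
    = -(70 / 27) + 10 * Real.pi / 9 - Real.pi ^ 2 / 9 + Real.pi ^ 3 / 96 := by
  rw [tailSeries_succ, tailSeries_one, weightedOddSum, leibnizTail_succ, leibnizTail_succ,
    leibnizTail_zero, oddHarmonic_succ, oddHarmonic_succ, oddHarmonic_zero]
  norm_num
  ring

lemma tailSeries_add_two (r : ℕ) :
    tailSeries (r + 2) = tailSeries r + weightedOddSum (r + 1) - weightedOddSum r := by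
  rw [tailSeries_succ (r + 1), tailSeries_succ r]
  ring

/-- The increment of `tailSeries` over two steps. -/
lemma weightedOddSum_succ_sub (r : ℕ) :
    weightedOddSum (r + 1) - weightedOddSum r
      = -(Real.pi ^ 2 / 3) / ((2 * (r : ℝ) + 3) * (2 * r + 1)) - 2 / (2 * (r : ℝ) + 3) ^ 3
        + 16 * (r + 1) * oddHarmonic (r + 1) / ((2 * (r : ℝ) + 3) ^ 2 * (2 * r + 1) ^ 2)
        + 4 / (2 * (r : ℝ) + 3) ^ 3
        - 8 * (4 * r ^ 2 + 8 * r + 5) * leibnizTail (r + 1)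
          / ((2 * (r : ℝ) + 3) ^ 2 * (2 * r + 1) ^ 2) := by
  -- Everything is reduced to index r+1; the two cubic terms are the leftovers of O(r+2) and G(r+2).
  rw [weightedOddSum, weightedOddSum, oddHarmonic_succ (r + 1), leibnizTail_succ (r + 1)]
  have h1 : 2 * ((r + 1 : ℕ) : ℝ) + 1 = 2 * r + 3 := by push_cast; ring
  rw [h1]
  field_simp
  ring

lemma tailSeries_odd (N : ℕ) : tailSeries (2 * N + 1) =
      2
        + 16 * ∑ j ∈ Finset.range N,
            (((j : ℝ) + 1) * (2 * (harmonic (4 * j + 3) : ℝ) - (harmonic (2 * j + 1) : ℝ)))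
              / ((4 * (j : ℝ) + 5) ^ 2 * (4 * (j : ℝ) + 3) ^ 2)
        + 2 * ∑ j ∈ Finset.range N, 1 / (4 * (j : ℝ) + 5) ^ 3
        + 8 * ∑ k ∈ Finset.range N, ∑ j ∈ Finset.range (2 * k + 2),
            ((-1 : ℝ) ^ j * (16 * (k : ℝ) ^ 2 + 32 * (k : ℝ) + 17))
              / ((2 * (j : ℝ) + 1) * (4 * (k : ℝ) + 5) ^ 2 * (4 * (k : ℝ) + 3) ^ 2)
        - (1 + ∑ j ∈ Finset.range N,
            (2 * (16 * (j : ℝ) ^ 2 + 32 * (j : ℝ) + 17))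
              / ((4 * (j : ℝ) + 5) ^ 2 * (4 * (j : ℝ) + 3) ^ 2)) * Real.pi
        + (1 / 2 - ∑ j ∈ Finset.range N,
            1 / ((4 * (j : ℝ) + 5) * (4 * (j : ℝ) + 3))) * (Real.pi ^ 2 / 3)
        - Real.pi ^ 3 / 96 := by
  induction N with
  | zero => rw [tailSeries_one]; simp; ring
  | succ N ih =>
    have hO := oddHarmonic_succ_eq (2 * N + 1)
    -- The π/4 in G(2N+2) feeds the coefficient of π, its partial sum the double sum.
    have hL := leibnizTail_eq (2 * N + 2)
    have hsgn : (-1 : ℝ) ^ (2 * N + 2) = 1 := Even.neg_one_pow ⟨N + 1, by ring⟩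
    rw [hsgn, one_mul] at hL
    have hinner : ∑ j ∈ Finset.range (2 * N + 2),
        ((-1 : ℝ) ^ j * (16 * (N : ℝ) ^ 2 + 32 * (N : ℝ) + 17))
          / ((2 * (j : ℝ) + 1) * (4 * (N : ℝ) + 5) ^ 2 * (4 * (N : ℝ) + 3) ^ 2)
        = (16 * (N : ℝ) ^ 2 + 32 * (N : ℝ) + 17)
          / ((4 * (N : ℝ) + 5) ^ 2 * (4 * (N : ℝ) + 3) ^ 2)
            * (Real.pi / 4 - leibnizTail (2 * N + 2)) := by
      rw [hL, sub_sub_cancel, mul_sum]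
      refine sum_congr rfl fun j _ => ?_
      field_simp
    have hstep := weightedOddSum_succ_sub (2 * N + 1)
    rw [hO, show 2 * (2 * N + 1) + 1 = 4 * N + 3 by ring] at hstep
    push_cast at hstep
    have h1 : 2 * (2 * (N : ℝ) + 1) + 3 = 4 * N + 5 := by ring
    have h2 : 2 * (2 * (N : ℝ) + 1) + 1 = 4 * N + 3 := by ring
    rw [h1, h2] at hstep
    rw [show 2 * (N + 1) + 1 = 2 * N + 1 + 2 by ring, tailSeries_add_two, add_sub_assoc, hstep, ih]
    simp only [sum_range_succ _ N]
    rw [hinner]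
    field_simp
    ring_nf

lemma tailSeries_even (N : ℕ) : tailSeries (2 * N + 2) =
      -(70 / 27)
        + 8 * ∑ j ∈ Finset.Icc 1 N,
            ((2 * (j : ℝ) + 1) * (2 * (harmonic (4 * j + 1) : ℝ) - (harmonic (2 * j) : ℝ)))
              / ((4 * (j : ℝ) + 3) ^ 2 * (4 * (j : ℝ) + 1) ^ 2)
        + 2 * ∑ j ∈ Finset.Icc 1 N, 1 / (4 * (j : ℝ) + 3) ^ 3
        - 8 * ∑ k ∈ Finset.Icc 1 N, ∑ j ∈ Finset.range (2 * k + 1),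
            ((-1 : ℝ) ^ j * (16 * (k : ℝ) ^ 2 + 16 * (k : ℝ) + 5))
              / ((2 * (j : ℝ) + 1) * (4 * (k : ℝ) + 3) ^ 2 * (4 * (k : ℝ) + 1) ^ 2)
        + (10 / 9 + ∑ j ∈ Finset.Icc 1 N,
            (2 * (16 * (j : ℝ) ^ 2 + 16 * (j : ℝ) + 5))
              / ((4 * (j : ℝ) + 3) ^ 2 * (4 * (j : ℝ) + 1) ^ 2)) * Real.pi
        - (1 / 3 + ∑ j ∈ Finset.Icc 1 N,
            1 / ((4 * (j : ℝ) + 3) * (4 * (j : ℝ) + 1))) * (Real.pi ^ 2 / 3)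
        + Real.pi ^ 3 / 96 := by
  induction N with
  | zero => rw [tailSeries_two]; simp; ring
  | succ N ih =>
    have hO := oddHarmonic_succ_eq (2 * (N + 1))
    -- The index is now odd, which flips the signs of the π term and of the double sum.
    have hL := leibnizTail_eq (2 * (N + 1) + 1)
    have hsgn : (-1 : ℝ) ^ (2 * (N + 1) + 1) = -1 := Odd.neg_one_pow ⟨N + 1, rfl⟩
    rw [hsgn] at hL
    set K : ℝ := ((N + 1 : ℕ) : ℝ) with hK
    have hK0 : 0 ≤ K := Nat.cast_nonneg _
    have hinner : ∑ j ∈ Finset.range (2 * (N + 1) + 1),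
        ((-1 : ℝ) ^ j * (16 * K ^ 2 + 16 * K + 5))
          / ((2 * (j : ℝ) + 1) * (4 * K + 3) ^ 2 * (4 * K + 1) ^ 2)
        = (16 * K ^ 2 + 16 * K + 5)
          / ((4 * K + 3) ^ 2 * (4 * K + 1) ^ 2)
            * (Real.pi / 4 + leibnizTail (2 * (N + 1) + 1)) := by
      have hL' : Real.pi / 4 + leibnizTail (2 * (N + 1) + 1)
          = ∑ j ∈ range (2 * (N + 1) + 1), (-1 : ℝ) ^ j / (2 * (j : ℝ) + 1) := by
        rw [hL]; ring
      rw [hL', mul_sum]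
      refine sum_congr rfl fun j _ => ?_
      field_simp
    have hstep := weightedOddSum_succ_sub (2 * (N + 1))
    have hK2 : ((2 * (N + 1) : ℕ) : ℝ) = 2 * K := by rw [hK]; push_cast; ring
    rw [hO, show 2 * (2 * (N + 1)) + 1 = 4 * (N + 1) + 1 by ring, hK2] at hstep
    have h1 : 2 * (2 * K) + 3 = 4 * K + 3 := by ring
    have h2 : 2 * (2 * K) + 1 = 4 * K + 1 := by ring
    rw [h1, h2] at hstep
    rw [tailSeries_add_two, add_sub_assoc, hstep, show 2 * (N + 1) = 2 * N + 2 by ring, ih]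
    simp only [sum_Icc_succ_top (Nat.le_add_left 1 N)]
    rw [hinner, ← hK, show 2 * (N + 1) = 2 * N + 2 by ring]
    field_simp
    ring_nf

theorem theorem10 (n : ℕ) :
    (∃ a₀ a₁ a₂ a₃ : ℚ, DigammaSeriesHasSum n
      ((a₀ : ℝ) + (a₁ : ℝ) * Real.pi + (a₂ : ℝ) * Real.pi ^ 2 + (a₃ : ℝ) * Real.pi ^ 3)) ∧
    (n = 0 → DigammaSeriesHasSum n
      (2 - Real.pi + Real.pi ^ 2 / 6 - Real.pi ^ 3 / 96)) ∧
    (n = 1 → DigammaSeriesHasSum n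
      (-(70 / 27) + 10 * Real.pi / 9 - Real.pi ^ 2 / 9 + Real.pi ^ 3 / 96)) ∧
    (Odd n → n ≠ 1 → DigammaSeriesHasSum n
      (-(70 / 27)
        + 8 * ∑ j ∈ Finset.Icc 1 ((n - 1) / 2),
            ((2 * (j : ℝ) + 1) * (2 * (harmonic (4 * j + 1) : ℝ) - (harmonic (2 * j) : ℝ)))
              / ((4 * (j : ℝ) + 3) ^ 2 * (4 * (j : ℝ) + 1) ^ 2)
        + 2 * ∑ j ∈ Finset.Icc 1 ((n - 1) / 2), 1 / (4 * (j : ℝ) + 3) ^ 3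
        - 8 * ∑ k ∈ Finset.Icc 1 ((n - 1) / 2), ∑ j ∈ Finset.range (2 * k + 1),
            ((-1 : ℝ) ^ j * (16 * (k : ℝ) ^ 2 + 16 * (k : ℝ) + 5))
              / ((2 * (j : ℝ) + 1) * (4 * (k : ℝ) + 3) ^ 2 * (4 * (k : ℝ) + 1) ^ 2)
        + (10 / 9 + ∑ j ∈ Finset.Icc 1 ((n - 1) / 2),
            (2 * (16 * (j : ℝ) ^ 2 + 16 * (j : ℝ) + 5))
              / ((4 * (j : ℝ) + 3) ^ 2 * (4 * (j : ℝ) + 1) ^ 2)) * Real.pi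
        - (1 / 3 + ∑ j ∈ Finset.Icc 1 ((n - 1) / 2),
            1 / ((4 * (j : ℝ) + 3) * (4 * (j : ℝ) + 1))) * (Real.pi ^ 2 / 3)
        + Real.pi ^ 3 / 96)) ∧
    (Even n → DigammaSeriesHasSum n
      (2
        + 16 * ∑ j ∈ Finset.range (n / 2),
            (((j : ℝ) + 1) * (2 * (harmonic (4 * j + 3) : ℝ) - (harmonic (2 * j + 1) : ℝ)))
              / ((4 * (j : ℝ) + 5) ^ 2 * (4 * (j : ℝ) + 3) ^ 2)
        + 2 * ∑ j ∈ Finset.range (n / 2), 1 / (4 * (j : ℝ) + 5) ^ 3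
        + 8 * ∑ k ∈ Finset.range (n / 2), ∑ j ∈ Finset.range (2 * k + 2),
            ((-1 : ℝ) ^ j * (16 * (k : ℝ) ^ 2 + 32 * (k : ℝ) + 17))
              / ((2 * (j : ℝ) + 1) * (4 * (k : ℝ) + 5) ^ 2 * (4 * (k : ℝ) + 3) ^ 2)
        - (1 + ∑ j ∈ Finset.range (n / 2),
            (2 * (16 * (j : ℝ) ^ 2 + 32 * (j : ℝ) + 17))
              / ((4 * (j : ℝ) + 5) ^ 2 * (4 * (j : ℝ) + 3) ^ 2)) * Real.pi
        + (1 / 2 - ∑ j ∈ Finset.range (n / 2),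
            1 / ((4 * (j : ℝ) + 5) * (4 * (j : ℝ) + 3))) * (Real.pi ^ 2 / 3)
        - Real.pi ^ 3 / 96)) := by
  have h := digammaSeriesHasSum_tailSeries n
  refine ⟨?_, ?_, ?_, ?_, ?_⟩
  · obtain ⟨a₀, a₁, a₂, a₃, ha⟩ := exists_rat_tailSeries (n + 1)
    exact ⟨a₀, a₁, a₂, a₃, ha ▸ h⟩
  · rintro rfl
    exact tailSeries_one ▸ h
  · rintro rfl
    exact tailSeries_two ▸ h
  · rintro ⟨N, rfl⟩ -
    rw [show (2 * N + 1 - 1) / 2 = N by omega, ← tailSeries_even]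
    exact h
  · rintro ⟨N, rfl⟩
    rw [show (N + N) / 2 = N by omega, ← tailSeries_odd, two_mul]
    exact h
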